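/- Let $\Sigma$ be a finite non-empty alphabet and let $\mathcal{U}=(Q,\Sigma,\delta,Q_0,F)$ be a nondeterministic Büchi automaton with finite state set $Q$, transition function $\delta:Q\times\Sigma\to 2^Q$, initial states $Q_0\neq\varnothing$ and final states $F\neq\varnothing$. An accepting run for $w=a_1a_2\ldots\in\Sigma^\omega$ is a sequence $q_0q_1q_2\ldots\in Q^\omega$ with $q_0\in Q_0$, $q_{i+1}\in\delta(q_i,a_{i+1})$ for all $i\ge 0$, and $q_i\in F$ for infinitely many $i$; let $\mathcal{L}_\omega(\mathcal{U})$ be the set of words in $\Sigma^\omega$ that have at least one accepting run. Suppose that $\mathcal{U}$ is unambiguous (each $w\in\Sigma^\omega$ has at most one accepting run) and strongly connected (every state is reachable from every state in the directed graph with an edge from $q$ to $p$ whenever $p\in\delta(q,a)$ for some $a\in\Sigma$). Let $\mathrm{Pr}$ denote the uniform probability measure on $\Sigma^\omega$, under which the letters are independent and uniformly distributed on $\Sigma$, and consider the linear equation system $$(*)\qquad \zeta_q \;=\; \frac{1}{|\Sigma|}\sum_{a\in\Sigma}\ \sum_{p\in\delta(q,a)}\zeta_p\qquad\text{for all } q\in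 Q$$ in real unknowns $(\zeta_q)_{q\in Q}$. Then the following statements are equivalent: 1. $\mathrm{Pr}(\mathcal{L}_\omega(\mathcal{U}))>0$; 2. $(*)$ has a strictly positive solution, i.e. a solution $(\zeta^*_q)_{q\in Q}$ with $\zeta^*_q>0$ for all $q\in Q$; 3. $(*)$ has a non-zero solution. -/

import Mathlib

open MeasureTheory Filter

/-- A nondeterministic Büchi automaton with state set `Q` and alphabet `A`; finiteness of `Q` and
`A` is assumed where it is used. Infinite words are functions `w : ℕ → A`, whose letters are
`w 0, w 1, …`. -/
structure NBA (Q A : Type*) where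
  /-- The transition function `δ : Q × A → 2^Q`. -/
  δ : Q → A → Finset Q
  /-- The set of initial states. -/
  init : Set Q
  /-- The set of accepting (final) states. -/
  final : Set Q

namespace NBA

variable {Q A : Type*}

/-- `ρ 0, ρ 1, …` is a run for the infinite word `w`, starting in an initial state. -/
def IsRun (U : NBA Q A) (w : ℕ → A) (ρ : ℕ → Q) : Prop :=
  ρ 0 ∈ U.init ∧ ∀ i, ρ (i + 1) ∈ U.δ (ρ i) (w i)

/-- An accepting run visits the set of final states infinitely often. -/
def IsAcceptingRun (U : NBA Q A) (w : ℕ → A) (ρ : ℕ → Q) : Prop :=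
  U.IsRun w ρ ∧ ∃ᶠ i in atTop, ρ i ∈ U.final

/-- The language of infinite words having at least one accepting run. -/
def omegaLanguage (U : NBA Q A) : Set (ℕ → A) :=
  {w | ∃ ρ, U.IsAcceptingRun w ρ}

/-- Each infinite word has at most one accepting run. -/
def Unambiguous (U : NBA Q A) : Prop :=
  ∀ w ρ ρ', U.IsAcceptingRun w ρ → U.IsAcceptingRun w ρ' → ρ = ρ'

/-- The edge relation of the directed graph underlying the automaton. -/
def Edge (U : NBA Q A) (p q : Q) : Prop :=
  ∃ a, q ∈ U.δ p a

/-- Every state is reachable from every state (by a path of length `≥ 0`). -/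
def StronglyConnected (U : NBA Q A) : Prop :=
  ∀ p q, Relation.ReflTransGen U.Edge p q

/-- `ζ` solves the linear system
`ζ q = (1 / |A|) * ∑ a, ∑ p ∈ δ(q, a), ζ p` for all states `q`. -/
def IsSolution [Fintype A] (U : NBA Q A) (ζ : Q → ℝ) : Prop :=
  ∀ q, ζ q = (1 / (Fintype.card A : ℝ)) * ∑ a, ∑ p ∈ U.δ q a, ζ p

end NBA

/-- The uniform probability measure on infinite words: the letters are independent and uniformly
distributed on the alphabet. -/
noncomputable def uniformWordMeasure (A : Type*) [Fintype A] [Nonempty A] [MeasurableSpace A] :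
    Measure (ℕ → A) :=
  Measure.infinitePi fun _ : ℕ => (PMF.uniformOfFintype A).toMeasure

/-!
The system `(*)` reads `M ζ = ζ` for a nonnegative matrix `M`. In an unambiguous, strongly connected
automaton a finite word labels at most one path between two given states, so the `(q, p)` entry of
`M ^ n` is the probability that a random word of length `n` labels a path from `q` to `p`. Hence the
powers of `M` are bounded, and Perron–Frobenius theory shows that every nonnegative subsolution
`x ≤ M x` is a solution, and is positive unless it vanishes.

Subsolutions abound. By the union bound, the probabilities that a random word labels an accepting
run from `q` form one, which gives a positive solution if the language has positive measure; `|ζ|`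
is one for every solution `ζ`. The probabilities of a run from `q` that avoids the final states form
one as well, and they vanish at final states, hence everywhere: almost surely no run stays away from
the final states from some time on. So it remains to see that words label an infinite path from `q`
with positive probability. For a positive solution `h`, the identity `h = M ^ n h` bounds the
probability of a path of length `n` from `q` below independently of `n`, and by König's lemma paths
of all lengths give an infinite one.
-/

section PerronFrobenius

open scoped Matrix

variable {ι : Type*} [Fintype ι] {M : Matrix ι ι ℝ}

theorem monotone_mulVec_of_nonneg (hM : ∀ i j, 0 ≤ M i j) : Monotone (M *ᵥ ·) :=
  fun _ _ hxy i => dotProduct_le_dotProduct_of_nonneg_left hxy (hM i)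

theorem abs_mulVec_le (hM : ∀ i j, 0 ≤ M i j) (x : ι → ℝ) : |M *ᵥ x| ≤ M *ᵥ |x| := fun i =>
  (Finset.abs_sum_le_sum_abs _ _).trans_eq <|
    Finset.sum_congr rfl fun j _ => by rw [abs_mul, abs_of_nonneg (hM i j), Pi.abs_apply]

variable [DecidableEq ι]

theorem pow_mulVec_eq_iterate (M : Matrix ι ι ℝ) (n : ℕ) (x : ι → ℝ) :
    M ^ n *ᵥ x = (M *ᵥ ·)^[n] x := by
  induction n with
  | zero => simp
  | succ n ih => rw [pow_succ', ← Matrix.mulVec_mulVec, ih, Function.iterate_succ_apply']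

theorem pos_of_mulVec_le (hM : ∀ i j, 0 ≤ M i j) (hpow : ∀ i j, ∃ n, 0 < (M ^ n) i j)
    {x : ι → ℝ} (hx : 0 ≤ x) (hMx : M *ᵥ x ≤ x) (hx0 : x ≠ 0) (i : ι) : 0 < x i := by
  obtain ⟨j, hj⟩ := Function.ne_iff.1 hx0
  obtain ⟨n, hn⟩ := hpow i j
  have hle : M ^ n *ᵥ x ≤ x := by
    rw [pow_mulVec_eq_iterate]
    exact (monotone_mulVec_of_nonneg hM).antitone_iterate_of_map_le hMx n.zero_le
  calc
    0 < (M ^ n) i j * x j := mul_pos hn ((hx j).lt_of_ne' hj)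
    _ ≤ (M ^ n *ᵥ x) i := Finset.single_le_sum (f := fun k => (M ^ n) i k * x k)
      (fun k _ => mul_nonneg (Matrix.pow_apply_nonneg hM n i k) (hx k)) (Finset.mem_univ j)
    _ ≤ x i := hle i

theorem exists_mulVec_eq_and_le (hM : ∀ i j, 0 ≤ M i j)
    (hbdd : ∃ C, ∀ n i j, (M ^ n) i j ≤ C) {x : ι → ℝ} (hx : 0 ≤ x) (hxM : x ≤ M *ᵥ x) :
    ∃ h, M *ᵥ h = h ∧ x ≤ h := by
  obtain ⟨C, hC⟩ := hbdd
  have hmono : Monotone fun n => (M *ᵥ ·)^[n] x :=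
    (monotone_mulVec_of_nonneg hM).monotone_iterate_of_le_map hxM
  have hbound (n : ℕ) (i : ι) : (M *ᵥ ·)^[n] x i ≤ ∑ j, C * x j := by
    rw [← pow_mulVec_eq_iterate]
    exact Finset.sum_le_sum fun j _ => mul_le_mul_of_nonneg_right (hC n i j) (hx j)
  have hlim := tendsto_atTop_ciSup hmono ⟨fun _ => ∑ j, C * x j, by
    rintro _ ⟨n, rfl⟩ i
    exact hbound n i⟩
  have hcont : Continuous (M *ᵥ ·) := by fun_prop
  exact ⟨_, isFixedPt_of_tendsto_iterate hlim hcont.continuousAt, hmono.ge_of_tendsto hlim 0⟩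

/-- Let `h ≥ x` be a fixed point of `M` and `c` the least number with `x ≤ c • h`. The defect
`c • h - x` is nonnegative, decreases under `M` and has a zero, so it vanishes. -/
theorem mulVec_eq_of_le_mulVec (hM : ∀ i j, 0 ≤ M i j) (hpow : ∀ i j, ∃ n, 0 < (M ^ n) i j)
    (hbdd : ∃ C, ∀ n i j, (M ^ n) i j ≤ C) {x : ι → ℝ} (hx : 0 ≤ x) (hxM : x ≤ M *ᵥ x) :
    M *ᵥ x = x := by
  by_cases hx0 : x = 0
  · simp [hx0]
  obtain ⟨h, hh, hxh⟩ := exists_mulVec_eq_and_le hM hbdd hx hxM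
  have hh0 : h ≠ 0 := by
    rintro rfl
    exact hx0 (le_antisymm hxh hx)
  have hpos := pos_of_mulVec_le hM hpow (hx.trans hxh) hh.le hh0
  obtain ⟨i, -⟩ := Function.ne_iff.1 hx0
  have : Nonempty ι := ⟨i⟩
  obtain ⟨m, hm⟩ := Finite.exists_max fun i => x i / h i
  set c := x m / h m
  have hxc : x ≤ c • h := fun i => (div_le_iff₀ (hpos i)).1 (hm i)
  have hdefect : M *ᵥ (c • h - x) ≤ c • h - x := by
    rw [Matrix.mulVec_sub, Matrix.mulVec_smul, hh]
    exact sub_le_sub_left hxM _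
  have hzero : (c • h - x) m = 0 := by simp [c, (hpos m).ne']
  have hxch : x = c • h := by
    by_contra hne
    exact (pos_of_mulVec_le hM hpow (sub_nonneg.2 hxc) hdefect
      (sub_ne_zero.2 (Ne.symm hne)) m).ne' hzero
  rw [hxch, Matrix.mulVec_smul, hh]

theorem pos_of_le_mulVec (hM : ∀ i j, 0 ≤ M i j) (hpow : ∀ i j, ∃ n, 0 < (M ^ n) i j)
    (hbdd : ∃ C, ∀ n i j, (M ^ n) i j ≤ C) {x : ι → ℝ} (hx : 0 ≤ x) (hxM : x ≤ M *ᵥ x)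
    (hx0 : x ≠ 0) (i : ι) : 0 < x i :=
  pos_of_mulVec_le hM hpow hx (mulVec_eq_of_le_mulVec hM hpow hbdd hx hxM).le hx0 i

end PerronFrobenius

/-- The infinite sequence with first term `a` followed by `w`, for words and for runs. -/
def consSeq {X : Type*} (a : X) (w : ℕ → X) : ℕ → X
  | 0 => a
  | n + 1 => w n

/-- The infinite sequence `w` without its first term. -/
def tailSeq {X : Type*} (w : ℕ → X) : ℕ → X := fun n => w (n + 1)

section Sequences

variable {X : Type*}

@[simp] theorem consSeq_zero (a : X) (w : ℕ → X) : consSeq a w 0 = a := rfl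

@[simp] theorem tailSeq_consSeq (a : X) (w : ℕ → X) : tailSeq (consSeq a w) = w := rfl

@[simp] theorem consSeq_zero_tailSeq (w : ℕ → X) : consSeq (w 0) (tailSeq w) = w := by
  funext n
  cases n <;> rfl

variable [MeasurableSpace X]

theorem measurable_tailSeq : Measurable (tailSeq : (ℕ → X) → ℕ → X) :=
  measurable_pi_lambda _ fun n => measurable_pi_apply (n + 1)

/-- Prepending a first term, as a measurable equivalence. -/
def consSeqMeasurableEquiv (X : Type*) [MeasurableSpace X] : X × (ℕ → X) ≃ᵐ (ℕ → X) where
  toFun x := consSeq x.1 x.2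
  invFun w := (w 0, tailSeq w)
  left_inv _ := rfl
  right_inv := consSeq_zero_tailSeq
  measurable_toFun := measurable_pi_lambda _ fun n => by
    cases n with
    | zero => exact measurable_fst
    | succ n => exact (measurable_pi_apply n).comp measurable_snd
  measurable_invFun := (measurable_pi_apply 0).prodMk measurable_tailSeq

theorem preimage_consSeq_pi (s : Finset ℕ) (t : ℕ → Set X) :
    consSeqMeasurableEquiv X ⁻¹' (s : Set ℕ).pi t =
      {a | 0 ∈ s → a ∈ t 0} ×ˢ
        ((s.preimage Nat.succ Nat.succ_injective.injOn : Finset ℕ) : Set ℕ).pi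
          fun n => t (n + 1) := by
  ext ⟨a, w⟩
  simp only [Set.mem_preimage, Set.mem_pi, Set.mem_prod, Set.mem_ofPred_eq, Finset.mem_coe,
    Finset.mem_preimage, consSeqMeasurableEquiv, MeasurableEquiv.coe_mk]
  refine ⟨fun h => ⟨h 0, fun n hn => h _ hn⟩, fun h n hn => ?_⟩
  cases n with
  | zero => exact h.1 hn
  | succ n => exact h.2 n hn

theorem map_consSeqMeasurableEquiv_prod_infinitePi (μ : ℕ → Measure X)
    [∀ n, IsProbabilityMeasure (μ n)] :
    ((μ 0).prod (Measure.infinitePi fun n => μ (n + 1))).map (consSeqMeasurableEquiv X) =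
      Measure.infinitePi μ := by
  refine Measure.eq_infinitePi μ fun s t ht => ?_
  have hhead : μ 0 {a | 0 ∈ s → a ∈ t 0} = ∏ n ∈ s with n = 0, μ n (t n) := by
    by_cases h : 0 ∈ s <;> simp [Finset.filter_eq', h]
  have htail : ∏ n ∈ s.preimage Nat.succ Nat.succ_injective.injOn, μ (n + 1) (t (n + 1)) =
      ∏ n ∈ s with n ≠ 0, μ n (t n) := by
    classical
    rw [Finset.prod_preimage' Nat.succ s Nat.succ_injective.injOn fun n => μ n (t n)]
    simp [Nat.pos_iff_ne_zero]
  rw [MeasurableEquiv.map_apply, preimage_consSeq_pi, Measure.prod_prod,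
    Measure.infinitePi_pi _ fun n _ => ht (n + 1), hhead, htail,
    Finset.prod_filter_mul_prod_filter_not]

theorem prod_apply_eq_tsum {Y : Type*} [MeasurableSpace Y] [Countable X]
    [MeasurableSingletonClass X] (μ : Measure X) (ν : Measure Y) [SFinite ν] (s : Set (X × Y)) :
    μ.prod ν s = ∑' a, μ {a} * ν (Prod.mk a ⁻¹' s) := by
  conv_lhs => rw [← Measure.sum_smul_dirac μ, Measure.prod_sum_left]
  rw [Measure.sum_apply_of_countable]
  simp only [Measure.prod_smul_left, Measure.dirac_prod, Measure.smul_apply, smul_eq_mul,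
    (measurableEmbedding_prodMk_left _).map_apply]

end Sequences

section UniformWordMeasure

variable {A : Type*} [Fintype A] [Nonempty A] [MeasurableSpace A]

instance : IsProbabilityMeasure (uniformWordMeasure A) := by
  unfold uniformWordMeasure
  infer_instance

variable [MeasurableSingletonClass A]

theorem uniformWordMeasure_real_eq_sum (S : Set (ℕ → A)) :
    (uniformWordMeasure A).real S =
      1 / Fintype.card A * ∑ a, (uniformWordMeasure A).real (consSeq a ⁻¹' S) := by
  have h : uniformWordMeasure A S =
      ∑ a, (Fintype.card A : ENNReal)⁻¹ * uniformWordMeasure A (consSeq a ⁻¹' S) := by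
    conv_lhs => rw [uniformWordMeasure, ← map_consSeqMeasurableEquiv_prod_infinitePi]
    rw [MeasurableEquiv.map_apply, prod_apply_eq_tsum, tsum_fintype]
    refine Finset.sum_congr rfl fun a _ => ?_
    rw [PMF.toMeasure_apply_singleton _ _ (measurableSet_singleton a),
      PMF.uniformOfFintype_apply]
    rfl
  simp only [measureReal_def, h, ← Finset.mul_sum, ENNReal.toReal_mul, ENNReal.toReal_inv,
    ENNReal.toReal_natCast, one_div, ENNReal.toReal_sum fun _ _ => measure_ne_top _ _]

end UniformWordMeasure

theorem exists_rank_of_reflTransGen {α : Type*} {r : α → α → Prop} {s : Set α}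
    (hs : ∀ x, ∃ y ∈ s, Relation.ReflTransGen r x y) :
    ∃ d : α → ℕ, ∀ x ∉ s, ∃ y, r x y ∧ d y < d x := by
  let level (n : ℕ) : Set α := (fun t => {x | ∃ y ∈ t, r x y})^[n] s
  have level_succ (n : ℕ) : level (n + 1) = {x | ∃ y ∈ level n, r x y} :=
    Function.iterate_succ_apply' _ n s
  have hlevel (x : α) : ∃ n, x ∈ level n := by
    obtain ⟨y, hy, hxy⟩ := hs x
    induction hxy using Relation.ReflTransGen.head_induction_on with
    | refl => exact ⟨0, hy⟩
    | head hxz _ ih =>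
      obtain ⟨n, hn⟩ := ih
      exact ⟨n + 1, level_succ n ▸ ⟨_, hn, hxz⟩⟩
  refine ⟨fun x => sInf {n | x ∈ level n}, fun x hx => ?_⟩
  have hmem : x ∈ level (sInf {n | x ∈ level n}) := Nat.sInf_mem (hlevel x)
  rcases hd : sInf {n | x ∈ level n} with _ | n
  · rw [hd] at hmem
    exact absurd hmem hx
  · rw [hd, level_succ] at hmem
    obtain ⟨y, hy, hxy⟩ := hmem
    exact ⟨y, hxy, (Nat.lt_succ_of_le (Nat.sInf_le hy)).trans_eq hd.symm⟩

/-- Off `s`, every step decreases the rank, so `s` is hit again and again. -/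
theorem exists_seq_frequently_mem {α : Type*} {r : α → α → Prop} {s : Set α}
    (hr : ∀ x, ∃ y, r x y) (hs : ∀ x, ∃ y ∈ s, Relation.ReflTransGen r x y) (x : α) :
    ∃ f : ℕ → α, f 0 = x ∧ (∀ n, r (f n) (f (n + 1))) ∧ ∃ᶠ n in atTop, f n ∈ s := by
  obtain ⟨d, hd⟩ := exists_rank_of_reflTransGen hs
  have hstep (x : α) : ∃ y, r x y ∧ (x ∉ s → d y < d x) := by
    by_cases hx : x ∈ s
    · exact (hr x).imp fun y hy => ⟨hy, absurd hx⟩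
    · exact (hd x hx).imp fun y hy => ⟨hy.1, fun _ => hy.2⟩
  choose next hnext hdecr using hstep
  have hvisit (y : α) : ∃ k, next^[k] y ∈ s := by
    induction hy : d y using Nat.strong_induction_on generalizing y with
    | _ n ih =>
      by_cases hys : y ∈ s
      · exact ⟨0, hys⟩
      · obtain ⟨k, hk⟩ := ih _ (hy ▸ hdecr y hys) (next y) rfl
        exact ⟨k + 1, hk⟩
  refine ⟨fun n => next^[n] x, rfl, fun n => ?_, frequently_atTop.2 fun n => ?_⟩
  · beta_reduce
    rw [Function.iterate_succ_apply']
    exact hnext _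
  · obtain ⟨k, hk⟩ := hvisit (next^[n] x)
    rw [← Function.iterate_add_apply] at hk
    exact ⟨k + n, Nat.le_add_left n k, hk⟩

theorem exists_rel_of_forall_reflTransGen {α : Type*} [Nontrivial α] {r : α → α → Prop}
    (hr : ∀ x y, Relation.ReflTransGen r x y) (x : α) : ∃ y, r x y := by
  obtain ⟨y, hyx⟩ := exists_ne x
  rcases (hr x y).cases_head with hxy | ⟨z, hxz, -⟩
  · exact absurd hxy.symm hyx
  · exact ⟨z, hxz⟩

/-- The sequence that follows `u` for the first `n` terms and then continues with `v`; it extends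
finite words and finite paths to infinite ones. -/
def spliceSeq {X : Type*} (n : ℕ) (u v : ℕ → X) : ℕ → X :=
  fun i => if i < n then u i else v (i - n)

theorem spliceSeq_of_lt {X : Type*} {n i : ℕ} (h : i < n) (u v : ℕ → X) :
    spliceSeq n u v i = u i :=
  if_pos h

theorem spliceSeq_add {X : Type*} (n i : ℕ) (u v : ℕ → X) : spliceSeq n u v (i + n) = v i := by
  simp [spliceSeq]

theorem frequently_atTop_add_iff {P : ℕ → Prop} (k : ℕ) :
    (∃ᶠ n in atTop, P (n + k)) ↔ ∃ᶠ n in atTop, P n := by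
  conv_rhs => rw [← map_add_atTop_eq_nat k, frequently_map]

namespace NBA

section Paths

variable {Q A : Type*}

/-- `ρ 0, …, ρ n` is a path labelled by the first `n` letters of `w`. Finite words and paths are
encoded as prefixes of infinite sequences. -/
def IsPath (U : NBA Q A) (n : ℕ) (w : ℕ → A) (ρ : ℕ → Q) : Prop :=
  ∀ i < n, ρ (i + 1) ∈ U.δ (ρ i) (w i)

/-- `ρ` is an infinite path labelled by `w` that starts in `q`, initial or not. -/
def IsRunFrom (U : NBA Q A) (q : Q) (w : ℕ → A) (ρ : ℕ → Q) : Prop :=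
  ρ 0 = q ∧ ∀ i, ρ (i + 1) ∈ U.δ (ρ i) (w i)

/-- The words whose first `n` letters label some path from `q` to `p`. -/
def pathWords (U : NBA Q A) (n : ℕ) (q p : Q) : Set (ℕ → A) :=
  {w | ∃ ρ, U.IsPath n w ρ ∧ ρ 0 = q ∧ ρ n = p}

/-- The words that label an infinite path from `q` with state sequence in `R`. -/
def runLanguage (U : NBA Q A) (R : Set (ℕ → Q)) (q : Q) : Set (ℕ → A) :=
  {w | ∃ ρ ∈ R, U.IsRunFrom q w ρ}

/-- The state sequences that satisfy the Büchi condition. -/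
def acceptingSeqs (U : NBA Q A) : Set (ℕ → Q) :=
  {ρ | ∃ᶠ i in atTop, ρ i ∈ U.final}

/-- The automaton has no diamonds: a finite word labels at most one path between two given
states. -/
def DiamondFree (U : NBA Q A) : Prop :=
  ∀ n w ρ ρ', U.IsPath n w ρ → U.IsPath n w ρ' → ρ 0 = ρ' 0 → ρ n = ρ' n → ∀ i ≤ n, ρ i = ρ' i

variable {U : NBA Q A} {n : ℕ} {q p : Q} {a : A} {w v : ℕ → A} {ρ ρ' σ : ℕ → Q}

theorem IsPath.cons (hρ : U.IsPath n w ρ) (h0 : ρ 0 ∈ U.δ q a) :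
    U.IsPath (n + 1) (consSeq a w) (consSeq q ρ) := by
  rintro (_ | i) hi
  · exact h0
  · exact hρ i (Nat.lt_of_succ_lt_succ hi)

theorem IsRunFrom.cons (hρ : U.IsRunFrom p w ρ) (hp : p ∈ U.δ q a) :
    U.IsRunFrom q (consSeq a w) (consSeq q ρ) := by
  obtain ⟨rfl, hstep⟩ := hρ
  refine ⟨rfl, ?_⟩
  rintro (_ | i)
  · exact hp
  · exact hstep i

theorem IsPath.splice (hρ : U.IsPath n w ρ) (hσ : U.IsRunFrom (ρ n) v σ) :
    U.IsRunFrom (ρ 0) (spliceSeq n w v) (spliceSeq n ρ σ) := by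
  obtain ⟨hσ0, hσ⟩ := hσ
  have hprefix : ∀ i ≤ n, spliceSeq n ρ σ i = ρ i := by
    intro i hi
    rcases hi.lt_or_eq with hi | rfl
    · exact spliceSeq_of_lt hi ρ σ
    · simpa [hσ0] using spliceSeq_add i 0 ρ σ
  refine ⟨hprefix 0 n.zero_le, fun i => ?_⟩
  rcases lt_or_ge i n with hi | hi
  · rw [hprefix _ hi, hprefix i hi.le, spliceSeq_of_lt hi]
    exact hρ i hi
  · obtain ⟨j, rfl⟩ := Nat.exists_eq_add_of_le' hi
    rw [Nat.add_right_comm, spliceSeq_add, spliceSeq_add, spliceSeq_add]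
    exact hσ j

theorem preimage_tailSeq_acceptingSeqs (U : NBA Q A) :
    tailSeq ⁻¹' U.acceptingSeqs = U.acceptingSeqs :=
  Set.ext fun ρ => frequently_atTop_add_iff (P := fun i => ρ i ∈ U.final) 1

theorem preimage_consSeq_runLanguage (U : NBA Q A) (R : Set (ℕ → Q)) (q : Q) (a : A) :
    consSeq a ⁻¹' U.runLanguage (tailSeq ⁻¹' R) q = ⋃ p ∈ U.δ q a, U.runLanguage R p := by
  ext w
  simp only [Set.mem_preimage, Set.mem_iUnion, exists_prop]
  constructor
  · rintro ⟨ρ, hR, rfl, hρ⟩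
    exact ⟨ρ 1, hρ 0, tailSeq ρ, hR, rfl, fun i => hρ (i + 1)⟩
  · rintro ⟨p, hp, ρ, hR, hρ⟩
    exact ⟨consSeq q ρ, hR, hρ.cons hp⟩

theorem pathWords_zero (U : NBA Q A) (q p : Q) : U.pathWords 0 q p = {_w | q = p} := by
  ext w
  constructor
  · rintro ⟨ρ, -, rfl, rfl⟩
    rfl
  · rintro rfl
    exact ⟨fun _ => q, fun i hi => absurd hi i.not_lt_zero, rfl, rfl⟩

theorem mem_pathWords_succ :
    w ∈ U.pathWords (n + 1) q p ↔ ∃ r ∈ U.δ q (w 0), tailSeq w ∈ U.pathWords n r p := by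
  constructor
  · rintro ⟨ρ, hρ, rfl, rfl⟩
    exact ⟨ρ 1, hρ 0 n.succ_pos, tailSeq ρ, fun i hi => hρ (i + 1) (Nat.succ_lt_succ hi), rfl, rfl⟩
  · rintro ⟨r, hr, ρ, hρ, rfl, rfl⟩
    exact ⟨consSeq q ρ, by simpa using hρ.cons hr, rfl, rfl⟩

theorem preimage_consSeq_pathWords_succ (U : NBA Q A) (n : ℕ) (q p : Q) (a : A) :
    consSeq a ⁻¹' U.pathWords (n + 1) q p = ⋃ r ∈ U.δ q a, U.pathWords n r p := by
  ext w
  simp [mem_pathWords_succ]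

theorem antitone_iUnion_pathWords (U : NBA Q A) (q : Q) :
    Antitone fun n => ⋃ p, U.pathWords n q p := by
  intro m n hmn w hw
  obtain ⟨_, ρ, hρ, h0, -⟩ := Set.mem_iUnion.1 hw
  exact Set.mem_iUnion.2 ⟨ρ m, ρ, fun i hi => hρ i (hi.trans_le hmn), h0, rfl⟩

theorem runLanguage_mono {R S : Set (ℕ → Q)} (h : R ⊆ S) (q : Q) :
    U.runLanguage R q ⊆ U.runLanguage S q := by
  rintro w ⟨ρ, hR, hρ⟩
  exact ⟨ρ, h hR, hρ⟩

theorem runLanguage_union (U : NBA Q A) (R S : Set (ℕ → Q)) (q : Q) :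
    U.runLanguage (R ∪ S) q = U.runLanguage R q ∪ U.runLanguage S q := by
  ext w
  simp only [runLanguage, Set.mem_union, Set.mem_ofPred_eq, or_and_right, exists_or]

/-- König's lemma, as compactness of the space of state sequences. -/
theorem iInter_iUnion_pathWords_subset [Finite Q] (U : NBA Q A) (q : Q) :
    ⋂ n, ⋃ p, U.pathWords n q p ⊆ U.runLanguage Set.univ q := by
  intro w hw
  let _ : TopologicalSpace Q := ⊥
  have : DiscreteTopology Q := ⟨rfl⟩
  let K (n : ℕ) : Set (ℕ → Q) := {ρ | U.IsPath n w ρ ∧ ρ 0 = q}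
  have hclosed (n : ℕ) : IsClosed (K n) := by
    have hstart : IsClosed {ρ : ℕ → Q | ρ 0 = q} :=
      isClosed_eq (continuous_apply 0) continuous_const
    have hstep (i : ℕ) : IsClosed {ρ : ℕ → Q | ρ (i + 1) ∈ U.δ (ρ i) (w i)} := by
      have hpair : Continuous fun ρ : ℕ → Q => (ρ i, ρ (i + 1)) := by fun_prop
      exact (isClosed_discrete {x | x.2 ∈ U.δ x.1 (w i)}).preimage hpair
    simp only [K, IsPath, Set.ofPred_and, Set.ofPred_forall]
    exact (isClosed_iInter fun i => isClosed_iInter fun _ => hstep i).inter hstart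
  have hnonempty (n : ℕ) : (K n).Nonempty := by
    obtain ⟨_, ρ, hρ, h0, -⟩ := Set.mem_iUnion.1 (Set.mem_iInter.1 hw n)
    exact ⟨ρ, hρ, h0⟩
  obtain ⟨ρ, hρ⟩ := IsCompact.nonempty_iInter_of_sequence_nonempty_isCompact_isClosed K
    (fun n _ hρ => ⟨fun i hi => hρ.1 i (hi.trans n.lt_succ_self), hρ.2⟩) hnonempty
    (hclosed 0).isCompact hclosed
  rw [Set.mem_iInter] at hρ
  exact ⟨ρ, trivial, (hρ 0).2, fun i => (hρ (i + 1)).1 i i.lt_succ_self⟩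

end Paths

section Unambiguous

variable {Q A : Type*} {U : NBA Q A}

theorem omegaLanguage_eq_biUnion (U : NBA Q A) :
    U.omegaLanguage = ⋃ q ∈ U.init, U.runLanguage U.acceptingSeqs q := by
  ext w
  simp only [Set.mem_iUnion, exists_prop]
  constructor
  · rintro ⟨ρ, ⟨h0, hstep⟩, hacc⟩
    exact ⟨ρ 0, h0, ρ, hacc, rfl, hstep⟩
  · rintro ⟨_, h0, ρ, hacc, rfl, hstep⟩
    exact ⟨ρ, ⟨h0, hstep⟩, hacc⟩

theorem Unambiguous.eq_of_isRunFrom (hU : U.Unambiguous) (hsc : U.StronglyConnected)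
    (hinit : U.init.Nonempty) {q : Q} {w : ℕ → A} {ρ ρ' : ℕ → Q} (hρ : U.IsRunFrom q w ρ)
    (hρ' : U.IsRunFrom q w ρ') (hacc : ρ ∈ U.acceptingSeqs) (hacc' : ρ' ∈ U.acceptingSeqs) :
    ρ = ρ' := by
  obtain ⟨q₀, hq₀⟩ := hinit
  induction hsc q₀ q generalizing w ρ ρ' with
  | refl =>
    obtain ⟨rfl, hstep⟩ := hρ
    obtain ⟨h0, hstep'⟩ := hρ'
    exact hU w ρ ρ' ⟨⟨hq₀, hstep⟩, hacc⟩ ⟨⟨h0 ▸ hq₀, hstep'⟩, hacc'⟩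
  | tail _ hedge ih =>
    obtain ⟨a, ha⟩ := hedge
    rw [← preimage_tailSeq_acceptingSeqs] at ih
    exact congrArg tailSeq (ih (hρ.cons ha) (hρ'.cons ha) hacc hacc')

theorem StronglyConnected.nonempty_runLanguage_acceptingSeqs [Nontrivial Q]
    (hsc : U.StronglyConnected) (hfinal : U.final.Nonempty) (q : Q) :
    (U.runLanguage U.acceptingSeqs q).Nonempty := by
  obtain ⟨f, hf⟩ := hfinal
  obtain ⟨ρ, h0, hstep, hacc⟩ := exists_seq_frequently_mem
    (exists_rel_of_forall_reflTransGen hsc) (fun p => ⟨f, hf, hsc p f⟩) q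
  choose w hw using hstep
  exact ⟨w, ρ, hacc, h0, hw⟩

/-- An accepting run from the common end state of two paths extends both to accepting runs on the
same word. -/
theorem Unambiguous.diamondFree (hU : U.Unambiguous) (hsc : U.StronglyConnected)
    (hinit : U.init.Nonempty) (hfinal : U.final.Nonempty) : U.DiamondFree := by
  intro n w ρ ρ' hρ hρ' h0 hn i hi
  rcases hi.lt_or_eq with hi | rfl
  swap
  · exact hn
  rcases subsingleton_or_nontrivial Q with _ | _
  · exact Subsingleton.elim _ _
  obtain ⟨v, σ, hacc, hσ⟩ := hsc.nonempty_runLanguage_acceptingSeqs hfinal (ρ n)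
  have hsplice (τ : ℕ → Q) : spliceSeq n τ σ ∈ U.acceptingSeqs := by
    refine (frequently_atTop_add_iff n).1 ?_
    simp only [spliceSeq_add]
    exact hacc
  have heq := hU.eq_of_isRunFrom hsc hinit (hρ.splice hσ) (h0 ▸ hρ'.splice (hn ▸ hσ))
    (hsplice ρ) (hsplice ρ')
  simpa only [spliceSeq_of_lt hi] using congrFun heq i

theorem DiamondFree.pairwiseDisjoint_pathWords (hU : U.DiamondFree) (n : ℕ) (q p : Q) (a : A) :
    (U.δ q a : Set Q).PairwiseDisjoint fun r => U.pathWords n r p := by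
  intro r hr r' hr' hne
  refine Set.disjoint_left.2 ?_
  rintro w ⟨ρ, hρ, rfl, hn⟩ ⟨ρ', hρ', rfl, hn'⟩
  exact hne (hU (n + 1) _ _ _ (hρ.cons hr) (hρ'.cons hr') rfl (hn.trans hn'.symm) 1
    (Nat.le_add_left 1 n))

end Unambiguous

section TransitionMatrix

open scoped Matrix

variable {Q A : Type*} [Fintype A] [DecidableEq Q]

/-- The matrix of the linear system: its `(q, p)` entry is the proportion of the letters `a` with
`p ∈ δ(q, a)`. -/
noncomputable def transitionMatrix (U : NBA Q A) : Matrix Q Q ℝ :=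
  Matrix.of fun q p => 1 / Fintype.card A * ∑ a, if p ∈ U.δ q a then 1 else 0

theorem transitionMatrix_nonneg (U : NBA Q A) (q p : Q) : 0 ≤ U.transitionMatrix q p := by
  simp only [transitionMatrix, Matrix.of_apply]
  positivity

theorem transitionMatrix_pos [Nonempty A] {U : NBA Q A} {q p : Q} (h : U.Edge q p) :
    0 < U.transitionMatrix q p := by
  obtain ⟨a, ha⟩ := h
  refine mul_pos (by positivity) (Finset.sum_pos' (fun b _ => by positivity) ⟨a, ?_⟩)
  simp [ha]

variable [Fintype Q]

theorem transitionMatrix_mulVec_apply (U : NBA Q A) (x : Q → ℝ) (q : Q) :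
    (U.transitionMatrix *ᵥ x) q = 1 / Fintype.card A * ∑ a, ∑ p ∈ U.δ q a, x p := by
  simp only [Matrix.mulVec, dotProduct, transitionMatrix, Matrix.of_apply, mul_assoc,
    ← Finset.mul_sum, Finset.sum_mul, ite_mul, one_mul, zero_mul]
  rw [Finset.sum_comm]
  simp only [Finset.sum_ite_mem, Finset.univ_inter]

theorem isSolution_iff_mulVec_eq {U : NBA Q A} {ζ : Q → ℝ} :
    U.IsSolution ζ ↔ U.transitionMatrix *ᵥ ζ = ζ := by
  simp only [IsSolution, funext_iff, transitionMatrix_mulVec_apply, eq_comm]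

theorem StronglyConnected.exists_pow_transitionMatrix_pos [Nonempty A] {U : NBA Q A}
    (hsc : U.StronglyConnected) (q p : Q) : ∃ n, 0 < (U.transitionMatrix ^ n) q p := by
  induction hsc q p using Relation.ReflTransGen.head_induction_on with
  | refl => exact ⟨0, by simp⟩
  | @head q r hqr _ ih =>
    obtain ⟨n, hn⟩ := ih
    refine ⟨n + 1, ?_⟩
    rw [pow_succ', Matrix.mul_apply]
    exact Finset.sum_pos' (fun s _ => mul_nonneg (U.transitionMatrix_nonneg q s)
      (Matrix.pow_apply_nonneg U.transitionMatrix_nonneg n s p))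
      ⟨r, Finset.mem_univ r, mul_pos (transitionMatrix_pos hqr) hn⟩

end TransitionMatrix

theorem measurableSet_pathWords {Q A : Type*} [Countable Q] [MeasurableSpace A]
    [DiscreteMeasurableSpace A] (U : NBA Q A) (n : ℕ) (q p : Q) :
    MeasurableSet (U.pathWords n q p) := by
  induction n generalizing q with
  | zero =>
    rw [pathWords_zero]
    exact .const _
  | succ n ih =>
    have hunion : U.pathWords (n + 1) q p =
        ⋃ r, (fun w => w 0) ⁻¹' {a | r ∈ U.δ q a} ∩ tailSeq ⁻¹' U.pathWords n r p := by
      ext w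
      simp [mem_pathWords_succ]
    rw [hunion]
    exact .iUnion fun r =>
      (measurable_pi_apply 0 (.of_discrete)).inter (measurable_tailSeq (ih r))

section Subsolutions

open scoped Matrix

variable {Q A : Type*} [Fintype A] [Nonempty A] {U : NBA Q A}

section Fintype

variable [Fintype Q] [DecidableEq Q]

theorem DiamondFree.pow_transitionMatrix_apply [MeasurableSpace A] [DiscreteMeasurableSpace A]
    (hU : U.DiamondFree) (n : ℕ) (q p : Q) :
    (U.transitionMatrix ^ n) q p = (uniformWordMeasure A).real (U.pathWords n q p) := by
  induction n generalizing q with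
  | zero => by_cases h : q = p <;> simp [pathWords_zero, h]
  | succ n ih =>
    calc
      (U.transitionMatrix ^ (n + 1)) q p
      _ = (U.transitionMatrix *ᵥ fun r => (U.transitionMatrix ^ n) r p) q := by
        rw [pow_succ']
        rfl
      _ = 1 / Fintype.card A *
          ∑ a, ∑ r ∈ U.δ q a, (uniformWordMeasure A).real (U.pathWords n r p) := by
        simp only [transitionMatrix_mulVec_apply, ih]
      _ = 1 / Fintype.card A *
          ∑ a, (uniformWordMeasure A).real (consSeq a ⁻¹' U.pathWords (n + 1) q p) := by
        congr! 2 with a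
        rw [preimage_consSeq_pathWords_succ, measureReal_biUnion_finset
          (hU.pairwiseDisjoint_pathWords n q p a) fun r _ => U.measurableSet_pathWords n r p]
      _ = (uniformWordMeasure A).real (U.pathWords (n + 1) q p) :=
        (uniformWordMeasure_real_eq_sum _).symm

theorem DiamondFree.pow_transitionMatrix_le_one (hU : U.DiamondFree) (n : ℕ) (q p : Q) :
    (U.transitionMatrix ^ n) q p ≤ 1 := by
  let _ : MeasurableSpace A := ⊤
  exact (hU.pow_transitionMatrix_apply n q p).trans_le measureReal_le_one

theorem DiamondFree.isSolution_and_pos_of_le_mulVec (hU : U.DiamondFree)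
    (hsc : U.StronglyConnected) {x : Q → ℝ} (hx : 0 ≤ x) (hxM : x ≤ U.transitionMatrix *ᵥ x)
    (hx0 : x ≠ 0) : U.IsSolution x ∧ ∀ q, 0 < x q := by
  have hM := U.transitionMatrix_nonneg
  have hpow := hsc.exists_pow_transitionMatrix_pos
  have hbdd : ∃ C, ∀ n q p, (U.transitionMatrix ^ n) q p ≤ C :=
    ⟨1, hU.pow_transitionMatrix_le_one⟩
  exact ⟨isSolution_iff_mulVec_eq.2 (mulVec_eq_of_le_mulVec hM hpow hbdd hx hxM),
    pos_of_le_mulVec hM hpow hbdd hx hxM hx0⟩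

theorem measureReal_runLanguage_preimage_tailSeq_le [MeasurableSpace A]
    [MeasurableSingletonClass A] (U : NBA Q A) (R : Set (ℕ → Q)) (q : Q) :
    (uniformWordMeasure A).real (U.runLanguage (tailSeq ⁻¹' R) q) ≤
      (U.transitionMatrix *ᵥ fun p => (uniformWordMeasure A).real (U.runLanguage R p)) q := by
  rw [uniformWordMeasure_real_eq_sum, transitionMatrix_mulVec_apply]
  gcongr with a
  rw [preimage_consSeq_runLanguage]
  exact measureReal_biUnion_finset_le _ _

theorem measureReal_runLanguage_le_mulVec [MeasurableSpace A] [MeasurableSingletonClass A]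
    (U : NBA Q A) {R : Set (ℕ → Q)} (hR : R ⊆ tailSeq ⁻¹' R) :
    (fun q => (uniformWordMeasure A).real (U.runLanguage R q)) ≤
      U.transitionMatrix *ᵥ fun q => (uniformWordMeasure A).real (U.runLanguage R q) := fun q =>
  (measureReal_mono (runLanguage_mono hR q)).trans
    (U.measureReal_runLanguage_preimage_tailSeq_le R q)

end Fintype

variable [Finite Q]

theorem DiamondFree.exists_pos_isSolution_of_ne_zero (hU : U.DiamondFree)
    (hsc : U.StronglyConnected) {ζ : Q → ℝ} (hsol : U.IsSolution ζ) (hζ : ζ ≠ 0) :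
    ∃ h : Q → ℝ, U.IsSolution h ∧ ∀ q, 0 < h q := by
  classical
  cases nonempty_fintype Q
  have hle := abs_mulVec_le U.transitionMatrix_nonneg ζ
  rw [isSolution_iff_mulVec_eq.1 hsol] at hle
  obtain ⟨q, hq⟩ := Function.ne_iff.1 hζ
  exact ⟨|ζ|, hU.isSolution_and_pos_of_le_mulVec hsc (abs_nonneg ζ) hle
    (Function.ne_iff.2 ⟨q, abs_ne_zero.2 hq⟩)⟩

variable [MeasurableSpace A] [DiscreteMeasurableSpace A]

theorem DiamondFree.measureReal_runLanguage_forall_notMem_final (hU : U.DiamondFree)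
    (hsc : U.StronglyConnected) (hfinal : U.final.Nonempty) (q : Q) :
    (uniformWordMeasure A).real (U.runLanguage {ρ | ∀ i, ρ i ∉ U.final} q) = 0 := by
  classical
  cases nonempty_fintype Q
  obtain ⟨f, hf⟩ := hfinal
  have hempty : U.runLanguage {ρ | ∀ i, ρ i ∉ U.final} f = ∅ := by
    refine Set.eq_empty_of_forall_notMem ?_
    rintro w ⟨ρ, hρ, rfl, -⟩
    exact hρ 0 hf
  by_contra hq
  have hpos := (hU.isSolution_and_pos_of_le_mulVec hsc (fun _ => measureReal_nonneg)
    (U.measureReal_runLanguage_le_mulVec (R := {ρ | ∀ i, ρ i ∉ U.final})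
      fun ρ hρ i => hρ (i + 1))
    (Function.ne_iff.2 ⟨q, hq⟩)).2 f
  simp [hempty] at hpos

theorem DiamondFree.measure_runLanguage_compl_acceptingSeqs (hU : U.DiamondFree)
    (hsc : U.StronglyConnected) (hfinal : U.final.Nonempty) (q : Q) :
    uniformWordMeasure A (U.runLanguage U.acceptingSeqsᶜ q) = 0 := by
  classical
  cases nonempty_fintype Q
  have hnull (n : ℕ) (q : Q) :
      (uniformWordMeasure A).real (U.runLanguage {ρ | ∀ i, ρ (i + n) ∉ U.final} q) = 0 := by
    induction n generalizing q with
    | zero => exact hU.measureReal_runLanguage_forall_notMem_final hsc hfinal q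
    | succ n ih =>
      refine le_antisymm ?_ measureReal_nonneg
      refine (U.measureReal_runLanguage_preimage_tailSeq_le
        {ρ | ∀ i, ρ (i + n) ∉ U.final} q).trans_eq ?_
      simp only [ih]
      exact congrFun (Matrix.mulVec_zero _) q
  refine measure_mono_null ?_ (measure_iUnion_null fun n => (measureReal_eq_zero_iff).1 (hnull n q))
  rintro w ⟨ρ, hρ, hrun⟩
  obtain ⟨n, hn⟩ := eventually_atTop.1 (not_frequently.1 hρ)
  exact Set.mem_iUnion.2 ⟨n, ρ, fun i => hn _ (Nat.le_add_left n i), hrun⟩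

theorem DiamondFree.measureReal_iInter_iUnion_pathWords_pos (hU : U.DiamondFree) {h : Q → ℝ}
    (hsol : U.IsSolution h) (hpos : ∀ q, 0 < h q) (q : Q) :
    0 < (uniformWordMeasure A).real (⋂ n, ⋃ p, U.pathWords n q p) := by
  classical
  cases nonempty_fintype Q
  have hbound (n : ℕ) :
      h q ≤ (uniformWordMeasure A).real (⋃ p, U.pathWords n q p) * ∑ p, h p := by
    calc
      h q = (U.transitionMatrix ^ n *ᵥ h) q := by
        rw [pow_mulVec_eq_iterate, Function.iterate_fixed (isSolution_iff_mulVec_eq.1 hsol)]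
      _ = ∑ p, (uniformWordMeasure A).real (U.pathWords n q p) * h p :=
        Finset.sum_congr rfl fun p _ => congrArg (· * h p) (hU.pow_transitionMatrix_apply n q p)
      _ ≤ ∑ p, (uniformWordMeasure A).real (⋃ p, U.pathWords n q p) * h p := by
        gcongr with p
        · exact (hpos p).le
        · exact measure_ne_top _ _
        · exact Set.subset_iUnion (U.pathWords n q) p
      _ = (uniformWordMeasure A).real (⋃ p, U.pathWords n q p) * ∑ p, h p :=
        (Finset.mul_sum _ _ _).symm
  have hlim := (ENNReal.tendsto_toReal (measure_ne_top (uniformWordMeasure A) _)).comp <|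
    tendsto_measure_iInter_atTop
      (fun n => (MeasurableSet.iUnion fun p =>
        U.measurableSet_pathWords n q p).nullMeasurableSet)
      (U.antitone_iUnion_pathWords q) ⟨0, measure_ne_top (uniformWordMeasure A) _⟩
  have hle := ge_of_tendsto' (hlim.mul_const (∑ p, h p)) hbound
  exact pos_of_mul_pos_left ((hpos q).trans_le hle) (Finset.sum_nonneg fun p _ => (hpos p).le)

theorem DiamondFree.measure_runLanguage_acceptingSeqs_pos (hU : U.DiamondFree)
    (hsc : U.StronglyConnected) (hfinal : U.final.Nonempty) {h : Q → ℝ} (hsol : U.IsSolution h)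
    (hpos : ∀ q, 0 < h q) (q : Q) :
    0 < uniformWordMeasure A (U.runLanguage U.acceptingSeqs q) := by
  calc
    0 < uniformWordMeasure A (⋂ n, ⋃ p, U.pathWords n q p) :=
      (ENNReal.toReal_pos_iff.1 (hU.measureReal_iInter_iUnion_pathWords_pos hsol hpos q)).1
    _ ≤ uniformWordMeasure A (U.runLanguage Set.univ q) :=
      measure_mono (U.iInter_iUnion_pathWords_subset q)
    _ ≤ uniformWordMeasure A (U.runLanguage U.acceptingSeqs q) +
          uniformWordMeasure A (U.runLanguage U.acceptingSeqsᶜ q) := by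
      rw [← Set.union_compl_self U.acceptingSeqs, runLanguage_union]
      exact measure_union_le _ _
    _ = uniformWordMeasure A (U.runLanguage U.acceptingSeqs q) := by
      rw [hU.measure_runLanguage_compl_acceptingSeqs hsc hfinal q, add_zero]

theorem DiamondFree.exists_pos_isSolution_of_measure_omegaLanguage_pos (hU : U.DiamondFree)
    (hsc : U.StronglyConnected) (hL : 0 < uniformWordMeasure A U.omegaLanguage) :
    ∃ ζ : Q → ℝ, U.IsSolution ζ ∧ ∀ q, 0 < ζ q := by
  classical
  cases nonempty_fintype Q
  obtain ⟨q, -, hq⟩ : ∃ q ∈ U.init,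
      uniformWordMeasure A (U.runLanguage U.acceptingSeqs q) ≠ 0 := by
    rw [omegaLanguage_eq_biUnion] at hL
    contrapose! hL
    exact (measure_biUnion_null_iff U.init.to_countable).2 hL |>.le
  exact ⟨_, hU.isSolution_and_pos_of_le_mulVec hsc (fun _ => measureReal_nonneg)
    (U.measureReal_runLanguage_le_mulVec U.preimage_tailSeq_acceptingSeqs.ge)
    (Function.ne_iff.2 ⟨q, (measureReal_ne_zero_iff).2 hq⟩)⟩

end Subsolutions

end NBA

theorem mainTheorem2_general {Q A : Type*} [Finite Q] [Fintype A] [Nonempty A]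
    [MeasurableSpace A] [DiscreteMeasurableSpace A]
    (U : NBA Q A) (hU : U.DiamondFree) (hsc : U.StronglyConnected)
    (hinit : U.init.Nonempty) (hfinal : U.final.Nonempty) :
    List.TFAE [
      0 < uniformWordMeasure A U.omegaLanguage,
      ∃ ζ : Q → ℝ, U.IsSolution ζ ∧ ∀ q, 0 < ζ q,
      ∃ ζ : Q → ℝ, U.IsSolution ζ ∧ ζ ≠ 0] := by
  obtain ⟨q₀, hq₀⟩ := hinit
  tfae_have 1 → 2 := hU.exists_pos_isSolution_of_measure_omegaLanguage_pos hsc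
  tfae_have 2 → 3 := fun ⟨ζ, hsol, hpos⟩ => ⟨ζ, hsol, Function.ne_iff.2 ⟨q₀, (hpos q₀).ne'⟩⟩
  tfae_have 3 → 1 := by
    rintro ⟨ζ, hsol, hζ⟩
    obtain ⟨h, hsol, hpos⟩ := hU.exists_pos_isSolution_of_ne_zero hsc hsol hζ
    rw [NBA.omegaLanguage_eq_biUnion]
    exact (hU.measure_runLanguage_acceptingSeqs_pos hsc hfinal hsol hpos q₀).trans_le
      (measure_mono (Set.subset_biUnion_of_mem hq₀))
  tfae_finish

theorem mainTheorem2 {Q A : Type*} [Finite Q] [Fintype A] [Nonempty A]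
    [MeasurableSpace A] [DiscreteMeasurableSpace A]
    (U : NBA Q A) (hU : U.Unambiguous) (hsc : U.StronglyConnected)
    (hinit : U.init.Nonempty) (hfinal : U.final.Nonempty) :
    List.TFAE [
      0 < uniformWordMeasure A U.omegaLanguage,
      ∃ ζ : Q → ℝ, U.IsSolution ζ ∧ ∀ q, 0 < ζ q,
      ∃ ζ : Q → ℝ, U.IsSolution ζ ∧ ζ ≠ 0] :=
  mainTheorem2_general U (hU.diamondFree hsc hinit hfinal) hsc hinit hfinal
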